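/- Let $\mathcal A$ be a (locally small) complete, cocomplete and wellpowered category in which every epimorphism splits and which has stable monomorphisms; for example $\mathsf{Set}^S$, $K$-$\mathsf{Vec}$ or $\mathsf{Set}_\ast$ (sets and partial functions). Here a cocomplete category is said to have *stable monomorphisms* if (a) for every small family of monomorphisms $f_i : X_i \to Y_i$ the coproduct $\coprod_i f_i : \coprod_i X_i \to \coprod_i Y_i$ is a monomorphism, and (b) for every small well-ordered (possibly empty) chain of monomorphisms, the colimit injections are monomorphisms, and for every cocone of the chain consisting of monomorphisms the induced morphism from the colimit is a monomorphism. Let $\mathbb S_i = (S_i, \mu_i, \eta_i)$, $i \in I$, be a family of monads on $\mathcal A$ indexed by a (possibly empty) set $I$, such that every endofunctor $S_i$ preserves monomorphisms. Suppose that the family has *arbitrarily large joint pre-fixpoints*: for every object $A$ and every cardinal $\alpha > 0$ there exists an object $X$ such that for every $i \in I$ there is a monomorphism $S_i X \to X$, and such that $X + A \cong X \cong \coprod_\alpha X$. Then the family $(\mathbb S_i)_{i \in I}$ has a coproduct in the category $\mathrm{Monad}(\mathcal A)$ of all monads on $\mathcal A$ and monad morphisms. -/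

import Mathlib

open CategoryTheory CategoryTheory.Limits

universe v u

/-- A cocomplete category has *stable monomorphisms* if coproducts of (small) families of
monomorphisms are monomorphisms and, for every (small, possibly empty) well-ordered chain of
monomorphisms, the colimit injections are monomorphisms and the morphism out of the colimit
induced by any cocone of monomorphisms is a monomorphism. -/
class HasStableMonos (C : Type u) [Category.{v} C] [HasColimits C] : Prop where
  mono_sigma_map : ∀ {I : Type v} {X Y : I → C} (f : ∀ i, X i ⟶ Y i),
    (∀ i, Mono (f i)) → Mono (Limits.Sigma.map f)
  mono_chain_ι : ∀ {J : Type v} [LinearOrder J] [WellFoundedLT J] (D : J ⥤ C),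
    (∀ {i j : J} (f : i ⟶ j), Mono (D.map f)) →
      ∀ (c : Cocone D), IsColimit c → ∀ j, Mono (c.ι.app j)
  mono_chain_desc : ∀ {J : Type v} [LinearOrder J] [WellFoundedLT J] (D : J ⥤ C),
    (∀ {i j : J} (f : i ⟶ j), Mono (D.map f)) →
      ∀ (c : Cocone D) (hc : IsColimit c) (d : Cocone D),
        (∀ j, Mono (d.ι.app j)) → Mono (hc.desc d)

/-- `X` is a *pre-fixpoint* of `H` if `H X` is a subobject of `X`: there is some monomorphism
from `H X` to `X`. -/
def IsPreFixpoint {C : Type u} [Category.{v} C] (H : C ⥤ C) (X : C) : Prop :=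
  ∃ m : H.obj X ⟶ X, Mono m

/-- A family of endofunctors has *arbitrarily large joint pre-fixpoints* if for every object `A`
and every cardinal `α > 0` (given by a nonempty set) some joint pre-fixpoint `X` satisfies
`X + A ≅ X ≅ ∐_α X`. -/
def HasArbitrarilyLargeJointPreFixpoints {C : Type u} [Category.{v} C] [HasColimits C]
    {I : Type v} (F : I → C ⥤ C) : Prop :=
  ∀ (A : C) (α : Type v) [Nonempty α], ∃ X : C,
    (∀ i, IsPreFixpoint (F i) X) ∧ Nonempty (X ⨿ A ≅ X) ∧ Nonempty (X ≅ ∐ fun _ : α => X)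

/-! A monad morphism `S i ⟶ R` turns every `R`-algebra into an `S i`-algebra. So if the forgetful
functor from joint algebras has a left adjoint, freeness makes the induced monad the coproduct
(`hasCoproduct_of_adjunction`).

The adjoint comes from the general adjoint functor theorem. Limits of joint algebras are created on
carriers, so only a solution set is needed (`solutionSetCondition_forget`). For an object `A`, a
large pre-fixpoint absorbs `A` and all the `S i`, so `K = A + ∐ S i` has a pre-fixpoint and hence a
weakly initial algebra `W`. Every `A ⟶ B` into a joint algebra then factors through the image of
some `W ⟶ B`. As epimorphisms split, this image is a subobject of `W`, and wellpoweredness leaves a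
set of them.

To find `W`, iterate `K` on the subobjects of the pre-fixpoint, keeping each stage a recursive
coalgebra; a fixed stage is the algebra sought. -/

/-- The transfinite iteration of an endomap `φ` of a complete lattice, starting at the
bottom. -/
noncomputable def ordinalIterate {P : Type u} [CompleteSemilatticeInf P] (φ : P → P)
    (a : Ordinal.{v}) : P :=
  sInf {t | ∀ b, b < a → φ (ordinalIterate φ b) ≤ t}
termination_by a

section OrdinalIterate

variable {P : Type u} [CompleteSemilatticeInf P] (φ : P → P)

theorem isLUB_ordinalIterate (a : Ordinal.{v}) :
    IsLUB (Set.range fun b : Set.Iio a => φ (ordinalIterate φ b.1)) (ordinalIterate φ a) := by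
  have h : upperBounds (Set.range fun b : Set.Iio a => φ (ordinalIterate φ b.1)) =
      {t | ∀ b, b < a → φ (ordinalIterate φ b) ≤ t} := by
    ext t
    simp [upperBounds]
  rw [ordinalIterate, IsLUB, h]
  refine ⟨?_, fun t ht => sInf_le ht⟩
  rw [← h]
  rintro _ ⟨b, rfl⟩
  exact le_sInf fun t ht => ht ⟨b, rfl⟩

theorem map_ordinalIterate_le {a b : Ordinal.{v}} (h : a < b) :
    φ (ordinalIterate φ a) ≤ ordinalIterate φ b :=
  (isLUB_ordinalIterate φ b).1 ⟨⟨a, h⟩, rfl⟩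

theorem monotone_ordinalIterate : Monotone (ordinalIterate.{v} φ) := fun a b h =>
  (isLUB_ordinalIterate φ a).2 (by
    rintro _ ⟨c, rfl⟩
    exact map_ordinalIterate_le φ (c.2.trans_le h))

variable {φ}

theorem ordinalIterate_le_map (hφ : Monotone φ) (a : Ordinal.{v}) :
    ordinalIterate φ a ≤ φ (ordinalIterate φ a) :=
  (isLUB_ordinalIterate φ a).2 (by
    rintro _ ⟨b, rfl⟩
    exact hφ (monotone_ordinalIterate φ (le_of_lt b.2)))

/-- A monotone endomap of a small complete lattice has a fixed point enjoying every property which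
is stable under the map and under suprema of small well-ordered chains. -/
theorem exists_fixedPoint_of_chain_induction [Small.{v} P] (hφ : Monotone φ) (Q : P → Prop)
    (hQφ : ∀ s, Q s → Q (φ s))
    (hQsup : ∀ {J : Type v} [LinearOrder J] [WellFoundedLT J] (g : J →o P), (∀ j, Q (g j)) →
      ∀ s, IsLUB (Set.range g) s → Q s) : ∃ s, φ s = s ∧ Q s := by
  have hQ : ∀ a : Ordinal.{v}, Q (ordinalIterate φ a) := by
    intro a
    induction a using WellFoundedLT.induction with
    | ind a ih =>
      refine hQsup (J := a.ToType)
        ⟨fun j => φ (ordinalIterate φ (Ordinal.ToType.mk.symm j).1), fun i j hij =>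
          hφ (monotone_ordinalIterate φ (Ordinal.ToType.mk.symm.monotone hij))⟩
        (fun j => hQφ _ (ih _ (Ordinal.ToType.mk.symm j).2)) _ ?_
      convert isLUB_ordinalIterate φ a using 1
      exact Ordinal.ToType.mk.symm.surjective.range_comp
        (fun b : Set.Iio a => φ (ordinalIterate φ b.1))
  -- Smallness of `P` enters here: the iteration must repeat a value, and it is stationary from
  -- there.
  have h := not_injective_of_ordinal (ordinalIterate.{v} φ)
  obtain ⟨a, b, hab, hne⟩ : ∃ a b : Ordinal.{v},
      ordinalIterate φ a = ordinalIterate φ b ∧ a < b := by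
    simp only [Function.Injective, not_forall] at h
    obtain ⟨a, b, hab, hne⟩ := h
    rcases lt_or_gt_of_ne hne with h | h
    · exact ⟨a, b, hab, h⟩
    · exact ⟨b, a, hab.symm, h⟩
  exact ⟨_, ((map_ordinalIterate_le φ hne).trans hab.ge).antisymm
    (ordinalIterate_le_map hφ a), hQ a⟩

end OrdinalIterate

/-! ### Initial algebras from pre-fixpoints -/

section InitialAlgebra

variable {C : Type u} [Category.{v} C] {K : C ⥤ C} {X : C}

/-- A morphism `j : Y ⟶ X` into a `K`-algebra `(X, m)` is a *recursive subcoalgebra* if `Y` carries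
a `K`-coalgebra structure for which `j` is a coalgebra-to-algebra morphism, and which has a unique
coalgebra-to-algebra morphism to every algebra. -/
def IsRecursiveSubcoalgebra (m : K.obj X ⟶ X) {Y : C} (j : Y ⟶ X) : Prop :=
  ∃ σ : Y ⟶ K.obj Y, σ ≫ K.map j ≫ m = j ∧
    ∀ (B : C) (b : K.obj B ⟶ B), ∃! h : Y ⟶ B, σ ≫ K.map h ≫ b = h

namespace IsRecursiveSubcoalgebra

variable {m : K.obj X ⟶ X}

theorem of_iso {Y Z : C} {j : Y ⟶ X} (hj : IsRecursiveSubcoalgebra m j) (e : Z ≅ Y)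
    {k : Z ⟶ X} (hk : e.hom ≫ j = k) : IsRecursiveSubcoalgebra m k := by
  obtain ⟨σ, hσ, hrec⟩ := hj
  refine ⟨e.hom ≫ σ ≫ K.map e.inv, ?_, fun B b => ?_⟩
  · rw [← hk, Category.assoc, Category.assoc, ← K.map_comp_assoc, e.inv_hom_id_assoc, hσ]
  · obtain ⟨h, hh, huniq⟩ := hrec B b
    refine ⟨e.hom ≫ h, ?_, fun k hk => ?_⟩
    · simp only [Category.assoc]
      rw [← K.map_comp_assoc, e.inv_hom_id_assoc, hh]
    · rw [← huniq (e.inv ≫ k), e.hom_inv_id_assoc]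
      simp only [Category.assoc] at hk
      conv_rhs => rw [← hk]
      rw [e.inv_hom_id_assoc, K.map_comp_assoc]

theorem map {Y : C} {j : Y ⟶ X} (hj : IsRecursiveSubcoalgebra m j) :
    IsRecursiveSubcoalgebra m (K.map j ≫ m) := by
  obtain ⟨σ, hσ, hrec⟩ := hj
  refine ⟨K.map σ, ?_, fun B b => ?_⟩
  · rw [← K.map_comp_assoc, hσ]
  · obtain ⟨h, hh, huniq⟩ := hrec B b
    refine ⟨K.map h ≫ b, ?_, fun k hk => ?_⟩
    · dsimp only
      rw [← K.map_comp_assoc, hh]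
    · have hk' : σ ≫ k = h := huniq _ (by
        dsimp only at hk ⊢
        conv_rhs => rw [← hk]
        rw [K.map_comp_assoc])
      rw [← hk', K.map_comp_assoc]
      exact hk.symm

/-- Everything is compared inside `X` through monomorphisms. This forces the coalgebra structures to
be compatible, so they glue; uniqueness of the recursive solutions makes those glue as well. -/
theorem of_isColimit [K.PreservesMonomorphisms] [Mono m] {J : Type v} [Preorder J] {D : J ⥤ C}
    {c : Cocone D} (hc : IsColimit c) {p : c.pt ⟶ X} [Mono p] [∀ j, Mono (c.ι.app j)]
    (hD : ∀ j, IsRecursiveSubcoalgebra m (c.ι.app j ≫ p)) : IsRecursiveSubcoalgebra m p := by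
  choose σ hσ hrec using hD
  have hmono : Mono (K.map p ≫ m) := inferInstance
  have hcompat : ∀ {i j : J} (f : i ⟶ j),
      D.map f ≫ σ j ≫ K.map (c.ι.app j) = σ i ≫ K.map (c.ι.app i) := by
    intro i j f
    rw [← cancel_mono (K.map p ≫ m)]
    simp only [Category.assoc]
    rw [← K.map_comp_assoc, ← K.map_comp_assoc, hσ, hσ, c.w_assoc]
  let s : c.pt ⟶ K.obj c.pt := hc.desc ⟨_, ⟨fun j => σ j ≫ K.map (c.ι.app j), fun i j f => by
    dsimp
    rw [Category.comp_id, hcompat]⟩⟩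
  have hs : ∀ j, c.ι.app j ≫ s = σ j ≫ K.map (c.ι.app j) := fun j => hc.fac _ j
  refine ⟨s, hc.hom_ext fun j => ?_, fun B b => ?_⟩
  · rw [reassoc_of% hs j, ← K.map_comp_assoc, hσ]
  · choose h hh huniq using fun j => hrec j B b
    dsimp only at hh
    have hDσ : ∀ {i j : J} (f : i ⟶ j), D.map f ≫ σ j = σ i ≫ K.map (D.map f) := by
      intro i j f
      rw [← cancel_mono (K.map (c.ι.app j ≫ p) ≫ m), Category.assoc, hσ, Category.assoc,
        ← K.map_comp_assoc, c.w_assoc, hσ]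
    have hcomp : ∀ {i j : J} (f : i ⟶ j), D.map f ≫ h j = h i := by
      intro i j f
      refine huniq i _ ?_
      dsimp only
      rw [K.map_comp_assoc, ← reassoc_of% hDσ f, hh]
    refine ⟨hc.desc ⟨_, ⟨h, fun i j f => by dsimp; rw [Category.comp_id, hcomp]⟩⟩,
      hc.hom_ext fun j => ?_, fun k hk => hc.hom_ext fun j => ?_⟩
    · rw [reassoc_of% hs j, ← K.map_comp_assoc, hc.fac, hh]
    · rw [hc.fac]
      refine huniq j _ ?_
      dsimp only at hk ⊢
      conv_rhs => rw [← hk]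
      rw [K.map_comp_assoc, reassoc_of% hs j]

end IsRecursiveSubcoalgebra

theorem isLUB_range_mk_of_isColimit {J : Type v} [Preorder J] (g : J →o Subobject X)
    {c : Cocone (g.monotone.functor ⋙ Subobject.underlying)} (hc : IsColimit c) (p : c.pt ⟶ X)
    [Mono p] (hp : ∀ j, c.ι.app j ≫ p = (g j).arrow) :
    IsLUB (Set.range g) (Subobject.mk p) := by
  refine ⟨?_, fun t ht => ?_⟩
  · rintro _ ⟨j, rfl⟩
    exact Subobject.le_mk_of_comm (c.ι.app j) (hp j)
  · have ht' : ∀ j, g j ≤ t := fun j => ht ⟨j, rfl⟩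
    let d : Cocone (g.monotone.functor ⋙ Subobject.underlying) :=
      ⟨(t : C), ⟨fun j => (g j).ofLE t (ht' j), fun i j f => by
        dsimp
        rw [Category.comp_id, ← cancel_mono t.arrow, Category.assoc, Subobject.ofLE_arrow,
          Subobject.ofLE_arrow]
        exact Subobject.underlying_arrow _⟩⟩
    refine Subobject.mk_le_of_comm (hc.desc d) (hc.hom_ext fun j => ?_)
    rw [hc.fac_assoc, hp]
    exact Subobject.ofLE_arrow _

/-- A functor preserving monomorphisms and having a pre-fixpoint has a (weakly)
initial algebra. -/
theorem exists_weaklyInitial_algebra_of_isPreFixpoint [HasLimits C] [HasColimits C]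
    [WellPowered.{v} C] [HasStableMonos C] [K.PreservesMonomorphisms] (hX : IsPreFixpoint K X) :
    ∃ (W : C) (w : K.obj W ⟶ W), ∀ (B : C) (b : K.obj B ⟶ B),
      ∃ h : W ⟶ B, w ≫ h = K.map h ≫ b := by
  obtain ⟨m, hm⟩ := hX
  let _ : CompleteSemilatticeInf (Subobject X) := Subobject.completeSemilatticeInf.{v}
  let φ : Subobject X → Subobject X := fun s => Subobject.mk (K.map s.arrow ≫ m)
  have hφ : Monotone φ := fun s t hst =>
    Subobject.mk_le_mk_of_comm (K.map (s.ofLE t hst)) (by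
      rw [← K.map_comp_assoc, Subobject.ofLE_arrow])
  obtain ⟨s, hs, σ, hσ, hrec⟩ := exists_fixedPoint_of_chain_induction.{v} hφ
    (fun s => IsRecursiveSubcoalgebra m s.arrow)
    (fun s hs => hs.map.of_iso (Subobject.underlyingIso _)
      ((Iso.eq_inv_comp _).1 (Subobject.underlyingIso_arrow _).symm))
    (by
      intro J _ _ g hg s hs
      let D : J ⥤ C := g.monotone.functor ⋙ Subobject.underlying
      have hD : ∀ {i j : J} (f : i ⟶ j), Mono (D.map f) := fun f =>
        inferInstanceAs (Mono (Subobject.ofLE _ _ (g.monotone (leOfHom f))))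
      let d : Cocone D := ⟨X, ⟨fun j => (g j).arrow, fun i j f =>
        (Subobject.underlying_arrow _).trans (Category.comp_id _).symm⟩⟩
      let p : colimit D ⟶ X := (colimit.isColimit D).desc d
      have hp : ∀ j, colimit.ι D j ≫ p = (g j).arrow := (colimit.isColimit D).fac d
      have hι : ∀ j, Mono ((colimit.cocone D).ι.app j) :=
        HasStableMonos.mono_chain_ι D hD _ (colimit.isColimit D)
      have : Mono p := HasStableMonos.mono_chain_desc D hD _ (colimit.isColimit D) d
        fun j => inferInstanceAs (Mono (g j).arrow)
      obtain rfl := hs.unique (isLUB_range_mk_of_isColimit g (colimit.isColimit D) p hp)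
      have hrec : IsRecursiveSubcoalgebra m p :=
        .of_isColimit (colimit.isColimit D)
          fun j => (congrArg (IsRecursiveSubcoalgebra m) (hp j)).mpr (hg j)
      exact hrec.of_iso (Subobject.underlyingIso p)
        ((Iso.eq_inv_comp _).1 (Subobject.underlyingIso_arrow _).symm))
  -- The fixed point makes the coalgebra structure invertible, and its inverse is the algebra
  -- structure.
  let e : (s : C) ≅ K.obj s := Subobject.isoOfEqMk s (K.map s.arrow ≫ m) hs.symm
  have he : e.hom = σ := by
    rw [← cancel_mono (K.map s.arrow ≫ m), hσ]
    exact Subobject.ofLEMk_comp _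
  refine ⟨s, e.inv, fun B b => ?_⟩
  obtain ⟨h, hh, -⟩ := hrec B b
  refine ⟨h, ?_⟩
  rw [Iso.inv_comp_eq, he, hh]

end InitialAlgebra

/-! ### Consequences of stable monomorphisms -/

section StableMonos

variable {C : Type u} [Category.{v} C] [HasColimits C] [HasStableMonos C]

theorem HasStableMonos.mono_of_isInitial {Z X : C} (hZ : IsInitial Z) (f : Z ⟶ X) : Mono f := by
  -- An initial object is the colimit of the empty chain.
  let J := ULift.{v} (Fin 0)
  have : IsEmpty J := inferInstanceAs (IsEmpty (ULift (Fin 0)))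
  let _ : LinearOrder J := inferInstanceAs (LinearOrder (ULift (Fin 0)))
  have : WellFoundedLT J := ⟨wellFounded_of_isEmpty _⟩
  let D : J ⥤ C := (Functor.const J).obj Z
  let c : Cocone D := ⟨Z, 𝟙 _⟩
  let d : Cocone D := ⟨X, ⟨fun j => isEmptyElim j, fun j => isEmptyElim j⟩⟩
  let hc : IsColimit c := (isColimitEquivIsInitialOfIsEmpty C c).symm hZ
  have := HasStableMonos.mono_chain_desc D (fun {i} => isEmptyElim i) c hc d
    fun j => isEmptyElim j
  rwa [hZ.hom_ext f (hc.desc d)]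

/-- Factor the injection as the split monomorphism `A ⟶ 0 + A` followed by the coproduct of `0 ⟶ X`
and `𝟙 A`. -/
theorem HasStableMonos.mono_coprod_inr (X A : C) : Mono (coprod.inr : A ⟶ X ⨿ A) := by
  let Y : ULift.{v} Bool → C := fun i => bif i.down then A else X
  let Z : ULift.{v} Bool → C := fun i => bif i.down then A else ⊥_ C
  let f : ∀ i, Z i ⟶ Y i
    | ⟨true⟩ => 𝟙 A
    | ⟨false⟩ => initial.to X
  let r : ∀ i, Z i ⟶ A
    | ⟨true⟩ => 𝟙 A
    | ⟨false⟩ => initial.to A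
  have hf : ∀ i, Mono (f i)
    | ⟨true⟩ => inferInstanceAs (Mono (𝟙 A))
    | ⟨false⟩ => mono_of_isInitial initialIsInitial _
  have hmap : Mono (Limits.Sigma.map f) := mono_sigma_map f hf
  have hι : Mono (Sigma.ι Z ⟨true⟩) :=
    have : Mono (Sigma.ι Z ⟨true⟩ ≫ Limits.Sigma.desc r) :=
      (Sigma.ι_desc r ⟨true⟩).symm ▸ inferInstanceAs (Mono (𝟙 A))
    mono_of_mono _ (Limits.Sigma.desc r)
  have hfac : (Sigma.ι Z ⟨true⟩ ≫ Limits.Sigma.map f : A ⟶ ∐ Y) = Sigma.ι Y ⟨true⟩ :=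
    (Sigma.ι_map f ⟨true⟩).trans (Category.id_comp _)
  have hY : Mono (Sigma.ι Y ⟨true⟩ : A ⟶ ∐ Y) := hfac ▸ mono_comp _ _
  let a : X ⟶ ∐ Y := Sigma.ι Y ⟨false⟩
  let b : A ⟶ ∐ Y := Sigma.ι Y ⟨true⟩
  have : Mono (coprod.inr ≫ coprod.desc a b) := (coprod.inr_desc a b).symm ▸ hY
  exact mono_of_mono _ (coprod.desc a b)

/-- The coproduct of a family of endofunctors, computed objectwise. -/
@[simps]
noncomputable def pointwiseSigma {J : Type v} (G : J → C ⥤ C) : C ⥤ C where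
  obj X := ∐ fun j => (G j).obj X
  map f := Limits.Sigma.map fun j => (G j).map f

theorem preservesMonomorphisms_pointwiseSigma {J : Type v} (G : J → C ⥤ C)
    (hG : ∀ j, (G j).PreservesMonomorphisms) : (pointwiseSigma G).PreservesMonomorphisms :=
  ⟨fun f _ => HasStableMonos.mono_sigma_map _ fun j => (G j).map_mono f⟩

theorem HasArbitrarilyLargeJointPreFixpoints.exists_isPreFixpoint_pointwiseSigma {I : Type v}
    {F : I → C ⥤ C} (hF : HasArbitrarilyLargeJointPreFixpoints F) (A : C) :
    ∃ X, IsPreFixpoint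
      (pointwiseSigma fun o : Option I => o.elim ((Functor.const C).obj A) F) X := by
  -- One copy of `X` for each monad and one for `A`; `Option I` is nonempty even when `I` is empty.
  obtain ⟨X, hX, ⟨e⟩, ⟨e'⟩⟩ := hF A (Option I)
  choose m hm using hX
  have hA : Mono (coprod.inr ≫ e.hom : A ⟶ X) :=
    haveI := HasStableMonos.mono_coprod_inr X A
    mono_comp _ _
  let f : ∀ o : Option I, (o.elim ((Functor.const C).obj A) F).obj X ⟶ X
    | none => coprod.inr ≫ e.hom
    | some i => m i
  have hf : ∀ o, Mono (f o)
    | none => hA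
    | some i => hm i
  exact ⟨X, Limits.Sigma.map f ≫ e'.inv,
    @mono_comp _ _ _ _ _ _ (HasStableMonos.mono_sigma_map f hf) _ _⟩

end StableMonos

/-- If all epimorphisms split, then every morphism factors as a split epimorphism followed by a
monomorphism: coequalize its kernel pair. -/
theorem exists_splitEpi_mono_factorization {C : Type u} [Category.{v} C] [HasPullbacks C]
    [HasCoequalizers C] [SplitEpiCategory C] {W B : C} (h : W ⟶ B) :
    ∃ (Z : C) (q : W ⟶ Z) (t : Z ⟶ W) (j : Z ⟶ B), t ≫ q = 𝟙 Z ∧ q ≫ j = h ∧ Mono j := by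
  let q := coequalizer.π (pullback.fst h h) (pullback.snd h h)
  let j : _ ⟶ B := coequalizer.desc h pullback.condition
  have hqj : q ≫ j = h := coequalizer.π_desc _ _
  have hq : ∀ {Y : C} (a b : Y ⟶ W), a ≫ h = b ≫ h → a ≫ q = b ≫ q := fun a b hab => by
    rw [← pullback.lift_fst a b hab, Category.assoc, coequalizer.condition, pullback.lift_snd_assoc]
  have : IsSplitEpi q := SplitEpiCategory.isSplitEpi_of_epi q
  refine ⟨_, q, section_ q, j, IsSplitEpi.id q, hqj, ⟨fun a b hab => ?_⟩⟩
  have hj : section_ q ≫ h = j :=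
    (congrArg (section_ q ≫ ·) hqj.symm).trans (IsSplitEpi.id_assoc q j)
  simpa using hq (a ≫ section_ q) (b ≫ section_ q) (by
    rw [Category.assoc, Category.assoc, hj, hab])

/-! ### Joint algebras, their limits and the solution set -/

/-- A joint algebra for a family of monads: an object with an Eilenberg–Moore algebra structure
for each of them. -/
structure JointAlgebra {C : Type u} [Category.{v} C] {I : Type v}
    (S : I → CategoryTheory.Monad C) where
  carrier : C
  str : ∀ i, (S i).obj carrier ⟶ carrier
  unit : ∀ i, (S i).η.app carrier ≫ str i = 𝟙 carrier
  assoc : ∀ i, (S i).μ.app carrier ≫ str i = (S i).map (str i) ≫ str i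

namespace JointAlgebra

variable {C : Type u} [Category.{v} C] {I : Type v} {S : I → CategoryTheory.Monad C}

/-- Morphisms of joint algebras. -/
@[ext]
structure Hom (A B : JointAlgebra S) where
  f : A.carrier ⟶ B.carrier
  h : ∀ i, A.str i ≫ f = (S i).map f ≫ B.str i

@[simps]
instance : Category (JointAlgebra S) where
  Hom := Hom
  id A := ⟨𝟙 _, fun i => by simp⟩
  comp f g := ⟨f.f ≫ g.f, fun i => by
    rw [reassoc_of% f.h, g.h, Functor.map_comp, Category.assoc]⟩

@[ext]
theorem hom_ext {A B : JointAlgebra S} {f g : A ⟶ B} (h : f.f = g.f) : f = g := Hom.ext h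

variable (S) in
/-- The forgetful functor from joint algebras. -/
@[simps]
def forget : JointAlgebra S ⥤ C where
  obj A := A.carrier
  map f := f.f

/-- A joint algebra structure on a subobject closed under the operations. -/
def ofMono (B : JointAlgebra S) {Z : C} (j : Z ⟶ B.carrier) [Mono j]
    (a : ∀ i, (S i).obj Z ⟶ Z) (ha : ∀ i, a i ≫ j = (S i).map j ≫ B.str i) :
    JointAlgebra S where
  carrier := Z
  str := a
  unit i := by
    rw [← cancel_mono j, Category.assoc, ha]
    exact (CategoryTheory.Monad.unit_naturality_assoc _ (S i) j (B.str i)).symm.trans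
      ((congrArg (j ≫ ·) (B.unit i)).trans ((Category.comp_id j).trans (Category.id_comp j).symm))
  assoc i := by
    rw [← cancel_mono j, Category.assoc, Category.assoc, ha, ← Functor.map_comp_assoc, ha,
      ← CategoryTheory.Monad.mu_naturality_assoc _ (S i), B.assoc, Functor.map_comp_assoc]

section Limits

variable {J : Type v} [SmallCategory J] (F : J ⥤ JointAlgebra S)

section

variable {F} (c : Cone (F ⋙ forget S))

/-- The legs of a cone on carriers. -/
def leg (j : J) : c.pt ⟶ (F.obj j).carrier := c.π.app j

theorem leg_comp {j k : J} (f : j ⟶ k) : leg c j ≫ (F.map f).f = leg c k := c.w f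

/-- The cone inducing the operation of the `i`-th monad on the limit of carriers. -/
def strCone (i : I) : Cone (F ⋙ forget S) :=
  ⟨(S i).obj c.pt, ⟨fun j => (S i).map (leg c j) ≫ (F.obj j).str i, fun j k f =>
    (Category.id_comp _).trans (show (S i).map (leg c k) ≫ (F.obj k).str i =
        ((S i).map (leg c j) ≫ (F.obj j).str i) ≫ (F.map f).f by
      rw [Category.assoc, (F.map f).h i, ← leg_comp c f, Functor.map_comp_assoc])⟩⟩

variable {c} (hc : IsLimit c)

/-- The operation of the `i`-th monad on the limit of carriers. -/
def limitStr (i : I) : (S i).obj c.pt ⟶ c.pt := hc.lift (strCone c i)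

theorem limitStr_leg (i : I) (j : J) :
    limitStr hc i ≫ leg c j = (S i).map (leg c j) ≫ (F.obj j).str i := hc.fac _ j

theorem ext_leg (hc : IsLimit c) {Z : C} {f g : Z ⟶ c.pt} (h : ∀ j, f ≫ leg c j = g ≫ leg c j) :
    f = g :=
  hc.hom_ext h

/-- The limit of a diagram of joint algebras is computed on carriers. -/
def limitPoint : JointAlgebra S where
  carrier := c.pt
  str := limitStr hc
  unit i := ext_leg hc fun j => by
    rw [Category.assoc, limitStr_leg]
    exact (CategoryTheory.Monad.unit_naturality_assoc _ (S i) (leg c j) _).symm.trans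
      ((congrArg (leg c j ≫ ·) ((F.obj j).unit i)).trans
        ((Category.comp_id (leg c j)).trans (Category.id_comp (leg c j)).symm))
  assoc i := ext_leg hc fun j => by
    rw [Category.assoc, limitStr_leg, Category.assoc, limitStr_leg,
      ← CategoryTheory.Monad.mu_naturality_assoc, JointAlgebra.assoc, ← Functor.map_comp_assoc,
      ← Functor.map_comp_assoc, limitStr_leg]

/-- The cone over a diagram of joint algebras lifting a limit cone on carriers. -/
def limitCone : Cone F where
  pt := limitPoint hc
  π :=
    { app j := ⟨leg c j, fun i => limitStr_leg hc i j⟩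
      naturality _ _ f := hom_ext (c.π.naturality f) }

/-- The lifted cone is a limit cone. -/
def isLimitLimitCone : IsLimit (limitCone hc) where
  lift s :=
    let l : s.pt.carrier ⟶ c.pt := hc.lift ((forget S).mapCone s)
    have hl (j) : l ≫ leg c j = (s.π.app j).f := hc.fac _ j
    ⟨l, fun i => ext_leg hc fun j => by
      change (s.pt.str i ≫ l) ≫ leg c j = ((S i).map l ≫ limitStr hc i) ≫ leg c j
      rw [Category.assoc, Category.assoc, hl, limitStr_leg, ← Functor.map_comp_assoc, hl]
      exact (s.π.app j).h i⟩
  fac s j := hom_ext (hc.fac _ j)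
  uniq s m hm := hom_ext (hc.uniq ((forget S).mapCone s) m.f fun j => congrArg Hom.f (hm j))

end

instance [HasLimits C] : HasLimits (JointAlgebra S) :=
  ⟨fun _ _ => ⟨fun _ => ⟨⟨_, isLimitLimitCone (limit.isLimit _)⟩⟩⟩⟩

instance [HasLimits C] : PreservesLimits (forget S) :=
  ⟨⟨fun {_} => preservesLimit_of_preserves_limit_cone
    (isLimitLimitCone (limit.isLimit _)) (limit.isLimit (_ ⋙ forget S))⟩⟩

end Limits

/-- The weakly initial `W` need not satisfy the monad algebra laws. The image of `W ⟶ B` does,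
because it is a subobject of `B` closed under the operations. -/
theorem solutionSetCondition_forget [HasLimits C] [HasColimits C]
    [WellPowered.{v} C] [HasStableMonos C] [SplitEpiCategory C]
    (hmono : ∀ i, (S i).toFunctor.PreservesMonomorphisms)
    (hlarge : HasArbitrarilyLargeJointPreFixpoints fun i => (S i).toFunctor) :
    SolutionSetCondition.{v} (forget S) := by
  intro A
  let G : Option I → C ⥤ C := fun o => o.elim ((Functor.const C).obj A) fun i => (S i).toFunctor
  have hG : ∀ o, (G o).PreservesMonomorphisms
    | none => ⟨fun _ _ => inferInstanceAs (Mono (𝟙 A))⟩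
    | some i => hmono i
  have := preservesMonomorphisms_pointwiseSigma G hG
  obtain ⟨X, hX⟩ := hlarge.exists_isPreFixpoint_pointwiseSigma A
  obtain ⟨W, w, hW⟩ := exists_weaklyInitial_algebra_of_isPreFixpoint (K := pointwiseSigma G) hX
  let wA : A ⟶ W := Sigma.ι (fun o => (G o).obj W) none ≫ w
  let wS (i : I) : (S i).obj W ⟶ W := Sigma.ι (fun o => (G o).obj W) (some i) ≫ w
  have hW' (B : JointAlgebra S) (f : A ⟶ B.carrier) : ∃ h : W ⟶ B.carrier,
      wA ≫ h = f ∧ ∀ i, wS i ≫ h = (S i).map h ≫ B.str i := by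
    let b : ∀ o, (G o).obj B.carrier ⟶ B.carrier
      | none => f
      | some i => B.str i
    obtain ⟨h, hh⟩ := hW B.carrier (Limits.Sigma.desc b)
    have key (o : Option I) :
        Sigma.ι (fun o => (G o).obj W) o ≫ w ≫ h = (G o).map h ≫ b o :=
      (congrArg (Sigma.ι (fun o => (G o).obj W) o ≫ ·) hh).trans
        ((Sigma.ι_map_assoc (fun o => (G o).map h) o _).trans
          (congrArg ((G o).map h ≫ ·) (Sigma.ι_desc b o)))
    exact ⟨h, (Category.assoc _ _ _).trans ((key none).trans (Category.id_comp f)),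
      fun i => (Category.assoc _ _ _).trans (key (some i))⟩
  have : Small.{v} (Subobject W) := WellPowered.subobject_small W
  let ι : Type v := Σ s : Shrink.{v} (Subobject W),
    (A ⟶ (((equivShrink _).symm s : Subobject W) : C)) ×
    {a : ∀ i, (S i).obj (((equivShrink _).symm s : Subobject W) : C) ⟶
      (((equivShrink _).symm s : Subobject W) : C) //
      (∀ i, (S i).η.app _ ≫ a i = 𝟙 _) ∧ ∀ i, (S i).μ.app _ ≫ a i = (S i).map (a i) ≫ a i}
  refine ⟨ι, fun k => ⟨_, k.2.2.1, k.2.2.2.1, k.2.2.2.2⟩, fun k => k.2.1, fun B f => ?_⟩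
  obtain ⟨h, hA, hS⟩ := hW' B f
  obtain ⟨Z, q, t, j, htq, hqj, hj⟩ := exists_splitEpi_mono_factorization h
  -- The section `t` exhibits the image as a subobject of `W`, so it is indexed by the small set of
  -- these.
  have : IsSplitMono t := ⟨⟨q, htq⟩⟩
  obtain ⟨s, hs⟩ := (equivShrink (Subobject W)).symm.surjective (Subobject.mk t)
  let e : (((equivShrink _).symm s : Subobject W) : C) ≅ Z := Subobject.isoOfEqMk _ t hs
  let a i := (S i).map (e.hom ≫ t) ≫ wS i ≫ q ≫ e.inv
  have ha (i) : a i ≫ (e.hom ≫ j) = (S i).map (e.hom ≫ j) ≫ B.str i := by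
    have : e.hom ≫ j = (e.hom ≫ t) ≫ h := by
      rw [← hqj, Category.assoc, reassoc_of% htq]
    simp only [a, Category.assoc, e.inv_hom_id_assoc]
    rw [hqj, hS, this, ← Functor.map_comp_assoc, Category.assoc]
  let B' := B.ofMono (e.hom ≫ j) a ha
  exact ⟨⟨s, wA ≫ q ≫ e.inv, a, B'.unit, B'.assoc⟩, ⟨e.hom ≫ j, ha⟩, by
    change (wA ≫ q ≫ e.inv) ≫ e.hom ≫ j = f
    rw [Category.assoc, Category.assoc, e.inv_hom_id_assoc, hqj, hA]⟩

end JointAlgebra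

/-! ### The free joint algebra monad as a coproduct -/

namespace JointAlgebra

variable {C : Type u} [Category.{v} C] {I : Type v} {S : I → CategoryTheory.Monad C}

/-- The joint algebra on an algebra for a monad `R` receiving monad morphisms from each `S i`. -/
def ofMonadHom {R : CategoryTheory.Monad C} (σ : ∀ i, S i ⟶ R) (Z : R.Algebra) :
    JointAlgebra S where
  carrier := Z.A
  str i := (σ i).app Z.A ≫ Z.a
  unit i := (MonadHom.app_η_assoc (σ i) Z.A Z.a).trans Z.unit
  assoc i := by
    rw [MonadHom.app_μ_assoc, Z.assoc, Functor.map_comp, Category.assoc,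
      ← (σ i).naturality_assoc]

/-- Algebra morphisms for `R` are morphisms of the induced joint algebras. -/
def homOfMonadHom {R : CategoryTheory.Monad C} (σ : ∀ i, S i ⟶ R) {Y Z : R.Algebra} (f : Y ⟶ Z) :
    ofMonadHom σ Y ⟶ ofMonadHom σ Z :=
  ⟨f.f, fun i => by
    change ((σ i).app Y.A ≫ Y.a) ≫ f.f = (S i).map f.f ≫ (σ i).app Z.A ≫ Z.a
    rw [Category.assoc, ← f.h, (σ i).naturality_assoc]⟩

variable {L : C ⥤ JointAlgebra S} (adj : L ⊣ forget S)

/-- The unit of a free joint algebra. -/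
def freeUnit (A : C) : A ⟶ (L.obj A).carrier := adj.unit.app A

theorem free_hom_ext {A : C} {B : JointAlgebra S} {f g : L.obj A ⟶ B}
    (h : freeUnit adj A ≫ f.f = freeUnit adj A ≫ g.f) : f = g :=
  (adj.homEquiv A B).injective (by
    rw [adj.homEquiv_unit, adj.homEquiv_unit]
    exact h)

/-- The extension of a morphism to the free joint algebra. -/
def freeLift {A : C} {B : JointAlgebra S} (f : A ⟶ B.carrier) : L.obj A ⟶ B :=
  (adj.homEquiv A B).symm f

theorem freeUnit_freeLift {A : C} {B : JointAlgebra S} (f : A ⟶ B.carrier) :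
    freeUnit adj A ≫ (freeLift adj f).f = f := by
  have := (adj.homEquiv A B).apply_symm_apply f
  rw [adj.homEquiv_unit] at this
  exact this

theorem freeUnit_map {A B : C} (f : A ⟶ B) :
    freeUnit adj A ≫ (L.map f).f = f ≫ freeUnit adj B :=
  (adj.unit.naturality f).symm

/-- The multiplication of the free joint algebra monad, as a morphism of joint algebras. -/
def freeMul (A : C) : L.obj (L.obj A).carrier ⟶ L.obj A := adj.counit.app (L.obj A)

theorem freeUnit_freeMul (A : C) :
    freeUnit adj (L.obj A).carrier ≫ (freeMul adj A).f = 𝟙 _ :=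
  adj.right_triangle_components (L.obj A)

/-- The component at `A` of the injection of `S i` into the free joint algebra monad. -/
def inj (i : I) (A : C) : (S i).obj A ⟶ (L.obj A).carrier :=
  (S i).map (freeUnit adj A) ≫ (L.obj A).str i

/-- The operations of a free joint algebra are recovered from the injections and the multiplication;
uniqueness of `desc` rests on this. -/
theorem inj_mul (i : I) (A : C) :
    inj adj i (L.obj A).carrier ≫ (freeMul adj A).f = (L.obj A).str i := by
  rw [inj, Category.assoc, (freeMul adj A).h, ← Functor.map_comp_assoc, freeUnit_freeMul]
  simp

theorem inj_naturality (i : I) {A B : C} (f : A ⟶ B) :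
    (S i).map f ≫ inj adj i B = inj adj i A ≫ (L.map f).f := by
  rw [inj, inj, Category.assoc, (L.map f).h, ← Functor.map_comp_assoc, ← Functor.map_comp_assoc,
    freeUnit_map]

theorem unit_inj (i : I) (A : C) : (S i).η.app A ≫ inj adj i A = freeUnit adj A :=
  (CategoryTheory.Monad.unit_naturality_assoc _ (S i) (freeUnit adj A) _).symm.trans
    ((congrArg (freeUnit adj A ≫ ·) ((L.obj A).unit i)).trans (Category.comp_id (freeUnit adj A)))

theorem mul_inj (i : I) (A : C) : (S i).μ.app A ≫ inj adj i A =
    ((S i).map (inj adj i A) ≫ inj adj i (L.obj A).carrier) ≫ (freeMul adj A).f := by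
  rw [Category.assoc, inj_mul, inj, Functor.map_comp_assoc, ← (L.obj A).assoc,
    CategoryTheory.Monad.mu_naturality_assoc]

/-- The injection of `S i` into the free joint algebra monad. -/
def ι (i : I) : S i ⟶ adj.toMonad :=
  MonadHom.mk ⟨inj adj i, fun _ _ f => inj_naturality adj i f⟩ (unit_inj adj i) (mul_inj adj i)

section Desc

variable {R : CategoryTheory.Monad C} (σ : ∀ i, S i ⟶ R)

/-- The joint algebra on `R.obj A` induced by monad morphisms `S i ⟶ R`. -/
def target (A : C) : JointAlgebra S := ofMonadHom σ (R.free.obj A)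

/-- The component at `A` of the induced monad morphism. -/
def descHom (A : C) : L.obj A ⟶ target σ A :=
  freeLift adj (B := target σ A) (R.η.app A)

/-- The component at `A` of the induced monad morphism, on carriers. -/
def descApp (A : C) : (L.obj A).carrier ⟶ R.obj A := (descHom adj σ A).f

theorem unit_descApp (A : C) : freeUnit adj A ≫ descApp adj σ A = R.η.app A :=
  freeUnit_freeLift adj (B := target σ A) (R.η.app A)

theorem str_descApp (i : I) (A : C) : (L.obj A).str i ≫ descApp adj σ A =
    (S i).map (descApp adj σ A) ≫ (σ i).app (R.obj A) ≫ R.μ.app A :=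
  (descHom adj σ A).h i

theorem descApp_naturality {A B : C} (f : A ⟶ B) :
    (L.map f).f ≫ descApp adj σ B = descApp adj σ A ≫ R.map f := by
  have := free_hom_ext adj (f := L.map f ≫ descHom adj σ B)
    (g := descHom adj σ A ≫ homOfMonadHom σ (R.free.map f)) (by
      change freeUnit adj A ≫ (L.map f).f ≫ descApp adj σ B =
        freeUnit adj A ≫ descApp adj σ A ≫ R.map f
      rw [reassoc_of% freeUnit_map adj, unit_descApp, reassoc_of% unit_descApp adj σ]
      exact R.η.naturality f)
  exact congrArg Hom.f this

theorem mul_descApp (A : C) : (freeMul adj A).f ≫ descApp adj σ A =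
    ((L.map (descApp adj σ A)).f ≫ descApp adj σ (R.obj A)) ≫ R.μ.app A := by
  -- Associativity makes `R.μ` an algebra morphism, so both sides are joint algebra morphisms from a
  -- free object and may be compared on generators.
  let μhom : R.free.obj (R.obj A) ⟶ R.free.obj A := ⟨R.μ.app A, R.assoc A⟩
  have := free_hom_ext adj (f := freeMul adj A ≫ descHom adj σ A)
    (g := (L.map (descApp adj σ A) ≫ descHom adj σ (R.obj A)) ≫ homOfMonadHom σ μhom) (by
      change freeUnit adj (L.obj A).carrier ≫ (freeMul adj A).f ≫ descApp adj σ A =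
        freeUnit adj (L.obj A).carrier ≫
          ((L.map (descApp adj σ A)).f ≫ descApp adj σ (R.obj A)) ≫ R.μ.app A
      rw [reassoc_of% freeUnit_freeMul adj, Category.assoc, reassoc_of% freeUnit_map adj, reassoc_of% unit_descApp adj σ]
      exact ((congrArg (descApp adj σ A ≫ ·) (R.left_unit A)).trans
        (Category.comp_id (descApp adj σ A))).symm)
  exact congrArg Hom.f this

/-- The monad morphism out of the free joint algebra monad induced by monad morphisms
`S i ⟶ R`. -/
def desc : adj.toMonad ⟶ R :=
  MonadHom.mk ⟨descApp adj σ, fun _ _ f => descApp_naturality adj σ f⟩ (unit_descApp adj σ)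
    (mul_descApp adj σ)

theorem ι_desc (i : I) : ι adj i ≫ desc adj σ = σ i := by
  apply MonadHom.ext'
  funext A
  change ((S i).map (freeUnit adj A) ≫ (L.obj A).str i) ≫ descApp adj σ A = (σ i).app A
  rw [Category.assoc, str_descApp, ← Functor.map_comp_assoc, unit_descApp,
    (σ i).naturality_assoc]
  exact (congrArg ((σ i).app A ≫ ·) (R.right_unit A)).trans (Category.comp_id ((σ i).app A))

theorem desc_uniq (τ : adj.toMonad ⟶ R) (hτ : ∀ i, ι adj i ≫ τ = σ i) : τ = desc adj σ := by
  apply MonadHom.ext'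
  funext A
  let t (A : C) : (L.obj A).carrier ⟶ R.obj A := τ.app A
  have hnat {A B : C} (f : A ⟶ B) : (L.map f).f ≫ t B = t A ≫ R.map f := τ.naturality f
  have hμ : (freeMul adj A).f ≫ t A = ((L.map (t A)).f ≫ t (R.obj A)) ≫ R.μ.app A := τ.app_μ A
  have hι (i : I) (A : C) : inj adj i A ≫ t A = (σ i).app A :=
    congrArg (fun f : S i ⟶ R => f.app A) (hτ i)
  -- Compatibility with the multiplications and injections makes `τ` a joint algebra morphism at
  -- `A`, so freeness applies.
  let k : L.obj A ⟶ target σ A := ⟨t A, fun i => by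
    change (L.obj A).str i ≫ t A = (S i).map (t A) ≫ (σ i).app (R.obj A) ≫ R.μ.app A
    rw [← inj_mul adj, Category.assoc, hμ, ← hι, Category.assoc, Category.assoc,
      ← Category.assoc (inj adj i _), ← inj_naturality, Category.assoc]⟩
  have : k = descHom adj σ A := free_hom_ext adj ((τ.app_η A).trans (unit_descApp adj σ A).symm)
  exact congrArg Hom.f this

end Desc

/-- The free joint algebra monad is the coproduct of the given monads. -/
theorem hasCoproduct_of_adjunction (adj : L ⊣ forget S) : HasCoproduct S :=
  HasColimit.mk ⟨Cofan.mk adj.toMonad (ι adj), Cofan.IsColimit.mk _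
    (fun s => desc adj s.inj) (fun s i => ι_desc adj s.inj i)
    (fun s τ hτ => desc_uniq adj s.inj τ hτ)⟩

end JointAlgebra

theorem mainTheorem1 {C : Type u} [Category.{v} C] [HasLimits C] [HasColimits C]
    [WellPowered.{v} C] [HasStableMonos C] [SplitEpiCategory C]
    {I : Type v} (S : I → CategoryTheory.Monad C)
    (hmono : ∀ i, (S i).toFunctor.PreservesMonomorphisms)
    (hlarge : HasArbitrarilyLargeJointPreFixpoints fun i => (S i).toFunctor) :
    HasCoproduct S := by
  have := isRightAdjoint_of_preservesLimits_of_solutionSetCondition (JointAlgebra.forget S)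
    (JointAlgebra.solutionSetCondition_forget hmono hlarge)
  exact JointAlgebra.hasCoproduct_of_adjunction
    (Adjunction.ofIsRightAdjoint (JointAlgebra.forget S))
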